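/- Let $\mathcal H$ be a reproducing kernel Hilbert space of complex-valued functions on a set $X$, with kernel $k$ (so $f(w)=\langle f,k(\cdot,w)\rangle$ for $f\in\mathcal H$). Let $\mathrm{Mult}(\mathcal H)=\{\varphi:X\to\mathbb C:\ \varphi f\in\mathcal H\text{ for all }f\in\mathcal H\}$ be its multiplier algebra, with the norm $\|\varphi\|=\|M_\varphi\|$, where $M_\varphi f=\varphi f$. Assume: - $\mathcal H$ is normalized: there is $x_0\in X$ with $k(x,x_0)=1$ for all $x\in X$. - $\mathcal H$ is a complete Pick space: for all $r,n\in\mathbb N$, $z_1,\dots,z_n\in X$ and $W_1,\dots,W_n\in M_r(\mathbb C)$ such that the block matrix $[k(z_i,z_j)(I-W_iW_j^*)]_{i,j=1}^n$ is positive semidefinite, there is $\Phi\in M_r(\mathrm{Mult}(\mathcal H))$ of norm at most $1$ as an operator on $\mathcal H^r$ with $\Phi(z_i)=W_i$ for all $i$. - $X$ is a compact topological space, every function in $\mathcal H$ is continuous on $X$, and $\mathcal H$ separates the points of $X$. - $X$ is a maximal domain for $\mathcal H$: every non-zero bounded linear functional $\rho$ on $\mathcal H$ satisfying $\rho(fg)=\rho(f)\rho(g)$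 whenever $f,g,fg\in\mathcal H$ is the evaluation at a point of $X$. Let $\mathcal M$ be the maximal ideal space of $\mathrm{Mult}(\mathcal H)$, that is, the set of its characters with the Gelfand topology. Then the following are equivalent. 1. $\mathrm{Mult}(\mathcal H)=\mathcal H$ as vector spaces (of functions on $X$). 2. The corona theorem holds for $\mathrm{Mult}(\mathcal H)$: the characters of evaluation at points of $X$ are dense in $\mathcal M$. 3. The maximal ideal space of $\mathrm{Mult}(\mathcal H)$ is $X$: sending $x\in X$ to the character of evaluation at $x$ is a homeomorphism of $X$ onto $\mathcal M$. 4. The one-function corona theorem holds for $\mathrm{Mult}(\mathcal H)$: if $\varphi\in\mathrm{Mult}(\mathcal H)$ and $\inf_{x\in X}|\varphi(x)|>0$, then $1/\varphi\in\mathrm{Mult}(\mathcal H)$. 5. If $\varphi\in\mathrm{Mult}(\mathcal H)$ has no zero on $X$, then $1/\varphi\in\mathrm{Mult}(\mathcal H)$. -/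

import Mathlib

noncomputable section

namespace PickSpace

section Multipliers

variable {X : Type*} (H : Type*) [NormedAddCommGroup H] [InnerProductSpace ℂ H]
  [RKHS ℂ H X ℂ]

/-- The multiplier algebra `Mult(H)` of a reproducing kernel Hilbert space `H` of complex valued
functions on `X`, as an algebra of functions: all `φ : X → ℂ` with `φ f ∈ H` for all `f ∈ H`. -/
def multiplierAlgebra : Subalgebra ℂ (X → ℂ) where
  carrier := {φ | ∀ f : H, ∃ g : H, (g : X → ℂ) = φ * f}
  mul_mem' := by
    intro φ ψ hφ hψ f
    obtain ⟨g, hg⟩ := hψ f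
    obtain ⟨h, hh⟩ := hφ g
    exact ⟨h, by rw [hh, hg, mul_assoc]⟩
  add_mem' := by
    intro φ ψ hφ hψ f
    obtain ⟨g, hg⟩ := hφ f
    obtain ⟨h, hh⟩ := hψ f
    exact ⟨g + h, by rw [RKHS.coe_add, hg, hh, add_mul]⟩
  algebraMap_mem' := by
    intro c f
    refine ⟨c • f, ?_⟩
    rw [RKHS.coe_smul]
    ext x
    simp [Algebra.algebraMap_eq_smul_one]

/-- The multiplier algebra as a type. It is kept apart from the coercion of `multiplierAlgebra H`
to a type since the latter carries the topology of pointwise convergence, whereas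
`Mult(H)` carries the topology of the multiplier norm. -/
def Mult : Type _ := multiplierAlgebra H

instance : CommRing (Mult H) := inferInstanceAs (CommRing (multiplierAlgebra H))

instance : Algebra ℂ (Mult H) := inferInstanceAs (Algebra ℂ (multiplierAlgebra H))

instance : FunLike (Mult H) X ℂ where
  coe φ := φ.1
  coe_injective := fun _ _ h => Subtype.ext h

variable {H}

theorem Mult.exists_mul (φ : Mult H) (f : H) : ∃ g : H, (g : X → ℂ) = φ * f := φ.2 f

/-- The linear multiplication operator `f ↦ φ f` on `H`. -/
def Mult.mulLinear (φ : Mult H) : H →ₗ[ℂ] H where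
  toFun f := (φ.exists_mul f).choose
  map_add' f g := by
    apply DFunLike.coe_injective
    refine (φ.exists_mul (f + g)).choose_spec.trans ?_
    rw [RKHS.coe_add, RKHS.coe_add, (φ.exists_mul f).choose_spec, (φ.exists_mul g).choose_spec,
      mul_add]
  map_smul' c f := by
    apply DFunLike.coe_injective
    refine (φ.exists_mul (c • f)).choose_spec.trans ?_
    rw [RingHom.id_apply, RKHS.coe_smul, RKHS.coe_smul, (φ.exists_mul f).choose_spec,
      mul_smul_comm]

theorem Mult.mulLinear_apply (φ : Mult H) (f : H) (x : X) : φ.mulLinear f x = φ x * f x :=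
  congrFun (φ.exists_mul f).choose_spec x

variable [CompleteSpace H]

theorem Mult.continuous_mulLinear (φ : Mult H) : Continuous φ.mulLinear := by
  apply LinearMap.continuous_of_seq_closed_graph
  intro u f g hu hφu
  apply DFunLike.coe_injective
  ext x
  have h1 := ((RKHS.continuous_eval (H := H) x).tendsto g).comp hφu
  have h2 := (((RKHS.continuous_eval (H := H) x).tendsto f).comp hu).const_mul (φ x)
  rw [φ.mulLinear_apply]
  refine tendsto_nhds_unique h1 (h2.congr fun n => ?_)
  simp [φ.mulLinear_apply]

variable (H) in
/-- The algebra homomorphism `φ ↦ M_φ` from `Mult(H)` to the bounded operators on `H`, where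
`M_φ f = φ f`; boundedness of `M_φ` comes from the closed graph theorem. -/
def mulOp : Mult H →ₐ[ℂ] (H →L[ℂ] H) where
  toFun φ := ⟨φ.mulLinear, φ.continuous_mulLinear⟩
  map_one' := by
    ext f x
    simpa using (Mult.mulLinear_apply (1 : Mult H) f x).trans (one_mul (f x))
  map_mul' φ ψ := by
    ext f x
    change (φ * ψ).mulLinear f x = φ.mulLinear (ψ.mulLinear f) x
    rw [Mult.mulLinear_apply, Mult.mulLinear_apply, Mult.mulLinear_apply, ← mul_assoc]
    rfl
  map_zero' := by
    ext f x
    simpa using (Mult.mulLinear_apply (0 : Mult H) f x).trans (zero_mul (f x))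
  map_add' φ ψ := by
    ext f x
    change (φ + ψ).mulLinear f x = (φ.mulLinear f + ψ.mulLinear f) x
    rw [RKHS.coe_add, Pi.add_apply, Mult.mulLinear_apply, Mult.mulLinear_apply,
      Mult.mulLinear_apply, ← add_mul]
    rfl
  commutes' c := by
    ext f x
    change (algebraMap ℂ (Mult H) c).mulLinear f x = (c • f) x
    rw [Mult.mulLinear_apply, RKHS.coe_smul]
    rfl

theorem mulOp_apply (φ : Mult H) (f : H) (x : X) : mulOp H φ f x = φ x * f x :=
  φ.mulLinear_apply f x

/-- The multiplier norm `‖φ‖ = ‖M_φ‖`. (In this generality a seminorm; it is a norm as soon as the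
kernel does not vanish on the diagonal, e.g. if the kernel is normalized.) -/
instance : SeminormedCommRing (Mult H) :=
  { SeminormedRing.induced (Mult H) (H →L[ℂ] H) (mulOp H) with
    mul_comm := mul_comm }

instance : NormedAlgebra ℂ (Mult H) where
  norm_smul_le c φ := by
    change ‖mulOp H (c • φ)‖ ≤ ‖c‖ * ‖mulOp H φ‖
    rw [map_smul]
    exact norm_smul_le _ _

theorem Mult.norm_eq (φ : Mult H) : ‖φ‖ = ‖mulOp H φ‖ := rfl

end Multipliers

section Spaces

variable {X : Type*} (H : Type*) [NormedAddCommGroup H] [InnerProductSpace ℂ H] [CompleteSpace H]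
  [RKHS ℂ H X ℂ]

/-- The scalar reproducing kernel `k(z, w)`, with `f(w) = ⟨f, k(·, w)⟩` for `f ∈ H`. -/
def ker (z w : X) : ℂ := RKHS.kernel H z w 1

/-- The kernel is normalized at some point `x₀`: `k(x, x₀) = 1` for all `x`. -/
def IsNormalized : Prop := ∃ x₀ : X, ∀ x : X, ker H x x₀ = 1

open scoped Matrix ComplexOrder in
/-- The complete Pick property: whenever `W₁, …, Wₙ` are `r × r` matrices and the block matrix
`[k(zᵢ, zⱼ) (I - Wᵢ Wⱼ*)]` is positive semidefinite, there is `Φ ∈ M_r(Mult(H))` with norm at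
most one as an operator on the Hilbert space direct sum of `r` copies of `H`, and
`Φ(zᵢ) = Wᵢ` for all `i`. -/
def IsCompletePick : Prop :=
  ∀ (r n : ℕ) (z : Fin n → X) (W : Fin n → Matrix (Fin r) (Fin r) ℂ),
    (Matrix.of fun p q : Fin n × Fin r =>
      ker H (z p.1) (z q.1) * (1 - W p.1 * (W q.1)ᴴ) p.2 q.2).PosSemidef →
    ∃ Φ : Matrix (Fin r) (Fin r) (Mult H),
      (∀ h : Fin r → H, ∑ i, ‖∑ j, mulOp H (Φ i j) (h j)‖ ^ 2 ≤ ∑ j, ‖h j‖ ^ 2) ∧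
      ∀ (i : Fin n) (a b : Fin r), Φ a b (z i) = W i a b

/-- A nonzero bounded functional `ρ` on `H` is partially multiplicative if
`ρ(f g) = ρ(f) ρ(g)` whenever `f`, `g` and `f g` belong to `H`. -/
def IsPartiallyMultiplicative (ρ : H →L[ℂ] ℂ) : Prop :=
  ρ ≠ 0 ∧ ∀ f g h : H, (h : X → ℂ) = f * g → ρ h = ρ f * ρ g

/-- `X` is a maximal domain for `H`: every partially multiplicative functional on `H` is the
evaluation at a point of `X`. -/
def IsMaximalDomain : Prop :=
  ∀ ρ : H →L[ℂ] ℂ, IsPartiallyMultiplicative H ρ → ∃ x : X, ∀ f : H, ρ f = f x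

/-- The maximal ideal space of `Mult(H)`: the characters (nonzero multiplicative continuous
linear functionals) of `Mult(H)` with the Gelfand (that is, the weak-*) topology. -/
abbrev MaxIdealSpace : Type _ := WeakDual.characterSpace ℂ (Mult H)

/-- The corona theorem holds for `Mult(H)`: the evaluations at points of `X` are dense in the
maximal ideal space of `Mult(H)`. -/
def CoronaTheorem : Prop :=
  Dense {χ : MaxIdealSpace H | ∃ x : X, ∀ φ : Mult H, χ φ = φ x}

/-- The one-function corona theorem holds for `Mult(H)`: if `φ ∈ Mult(H)` is bounded below
on `X`, then `1 / φ ∈ Mult(H)`. -/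
def OneFunctionCoronaTheorem : Prop :=
  ∀ φ ∈ multiplierAlgebra H, (∃ c : ℝ, 0 < c ∧ ∀ x : X, c ≤ ‖φ x‖) →
    (fun x => 1 / φ x) ∈ multiplierAlgebra H

end Spaces

end PickSpace

end

noncomputable section

open scoped ComplexOrder ComplexConjugate InnerProductSpace

namespace PickSpace

/-! ### Gram matrices over arbitrary index sets and norm inequalities. -/

section GramMatrices

/-! The cycle is 1 → 3 → 2 → 4 → 5 → 1. If every `f ∈ H` is a multiplier, the inclusion of `H` into
`Mult H` is bounded by the closed graph theorem, so a character restricts to a partially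
multiplicative functional, which is a point evaluation by maximality (`exists_character_eq_eval`). A
non-invertible multiplier is killed by a character, which density of the evaluations excludes when
it is bounded below. On compact `X` a zero-free continuous function is bounded below.

The substance is 5 → 1: each `f ∈ H` is a quotient of multipliers with zero-free denominator
(`IsCompletePick.exists_multiplier_quotient`), so inverting the denominator makes `f` a multiplier.
The Pick property gives `1 - 1/k ≥ 0` (`IsCompletePick.posSemidef_one_sub_inv`). Write `1 - 1/k(x,y)
= ⟪b x, b y⟫`; then `b x ⊗ f`, modelled by `τ x f`, carries a contractive row operator into `H`.
Hence `1 - 1/k(·,w)` multiplies with norm below one, and `k(·,w)` is a multiplier. For `‖f‖ = 1` and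
`u z = ⟪k(·,z) f, f⟫`, both `f/u` and `1 - 1/u` are contractive multipliers by the positivity
criterion `mem_multiplierAlgebra_of_inner`. -/

theorem _root_.Matrix.PosSemidef.of_entries_eq {ι : Type*} {M N : Matrix ι ι ℂ} (hN : N.PosSemidef)
    (h : ∀ i j, M i j = N i j) : M.PosSemidef := by
  rwa [show M = N from Matrix.ext h]

variable {ι E : Type*} [SeminormedAddCommGroup E] [InnerProductSpace ℂ E]

theorem ofReal_norm_sq (v : E) : ((‖v‖ ^ 2 : ℝ) : ℂ) = ⟪v, v⟫_ℂ := by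
  rw [inner_self_eq_norm_sq_to_K (𝕜 := ℂ)]
  push_cast
  rfl

theorem finsuppSum_gram (v : ι → E) (s : ι →₀ ℂ) :
    (s.sum fun i a => s.sum fun j b => star a * Matrix.gram ℂ v i j * b) =
      ((‖s.sum fun i a => a • v i‖ ^ 2 : ℝ) : ℂ) := by
  rw [ofReal_norm_sq]
  simp only [Finsupp.sum, sum_inner, inner_sum, inner_smul_left, inner_smul_right,
    Matrix.gram_apply]
  rw [Finset.sum_comm]
  refine Finset.sum_congr rfl fun i _ => ?_
  rw [Finset.mul_sum]
  refine Finset.sum_congr rfl fun j _ => ?_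
  simp only [Complex.star_def]
  ring

/-- A Gram matrix, over an arbitrary index set, minus a finite sum of Gram matrices. -/
theorem posSemidef_gram_sub_sum_gram {κ F : Type*} [Fintype κ] [SeminormedAddCommGroup F]
    [InnerProductSpace ℂ F] {f : ι → E} {g : κ → ι → F}
    (h : ∀ s : ι →₀ ℂ, ∑ l, ‖s.sum fun i a => a • g l i‖ ^ 2 ≤ ‖s.sum fun i a => a • f i‖ ^ 2) :
    (Matrix.gram ℂ f - ∑ l, Matrix.gram ℂ (g l)).PosSemidef := by
  refine ⟨(Matrix.isHermitian_gram ℂ f).sub ?_, fun s => ?_⟩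
  · simp only [Matrix.IsHermitian, Matrix.conjTranspose_sum]
    exact Finset.sum_congr rfl fun l _ => Matrix.isHermitian_gram ℂ (g l)
  · have : (s.sum fun i a => s.sum fun j b =>
        star a * (Matrix.gram ℂ f - ∑ l, Matrix.gram ℂ (g l)) i j * b) =
        (s.sum fun i a => s.sum fun j b => star a * Matrix.gram ℂ f i j * b) -
          ∑ l, s.sum fun i a => s.sum fun j b => star a * Matrix.gram ℂ (g l) i j * b := by
      simp only [Matrix.sub_apply, Matrix.sum_apply, mul_sub, sub_mul, Finset.mul_sum,
        Finset.sum_mul, Finsupp.sum, Finset.sum_sub_distrib]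
      congr 1
      simp only [Finset.sum_comm (s := Finset.univ)]
    rw [this]
    simp only [finsuppSum_gram]
    rw [← Complex.ofReal_sum, ← Complex.ofReal_sub]
    exact_mod_cast sub_nonneg.2 (h s)

theorem posSemidef_gram' (v : ι → E) : (Matrix.gram ℂ v).PosSemidef := by
  simpa using posSemidef_gram_sub_sum_gram (κ := Empty) (F := E) (f := v) (g := fun _ _ => 0)
    (fun s => by simp)

theorem posSemidef_gram_sub_gram {F : Type*} [SeminormedAddCommGroup F]
    [InnerProductSpace ℂ F] {f : ι → E} {g : ι → F}
    (h : ∀ s : ι →₀ ℂ, ‖s.sum fun i a => a • g i‖ ≤ ‖s.sum fun i a => a • f i‖) :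
    (Matrix.gram ℂ f - Matrix.gram ℂ g).PosSemidef := by
  simpa using posSemidef_gram_sub_sum_gram (κ := Unit) (f := f) (g := fun _ => g)
    (fun s => by simpa using pow_le_pow_left₀ (norm_nonneg _) (h s) 2)

theorem norm_le_of_posSemidef_gram_sub_gram {F : Type*} [SeminormedAddCommGroup F]
    [InnerProductSpace ℂ F] {f : ι → E} {g : ι → F}
    (h : (Matrix.gram ℂ f - Matrix.gram ℂ g).PosSemidef) (s : ι →₀ ℂ) :
    ‖s.sum fun i a => a • g i‖ ≤ ‖s.sum fun i a => a • f i‖ := by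
  have h1 := h.2 s
  simp only [Matrix.sub_apply, mul_sub, sub_mul, Finsupp.sum_sub, finsuppSum_gram] at h1
  rw [sub_nonneg] at h1
  exact (sq_le_sq₀ (norm_nonneg _) (norm_nonneg _)).1 (by exact_mod_cast h1)

end GramMatrices

/-! ### Kernel functions, adjoints of multipliers, and compression off one kernel function. -/

section Kernel

variable {X : Type*} (H : Type*) [NormedAddCommGroup H] [InnerProductSpace ℂ H] [CompleteSpace H]
  [RKHS ℂ H X ℂ]

/-- The kernel function `k(·, x)` as an element of `H`. -/
def kerVec (x : X) : H := RKHS.kerFun H x 1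

variable {H}

@[simp]
theorem inner_kerVec_left (x : X) (f : H) : ⟪kerVec H x, f⟫_ℂ = f x := by
  simp [kerVec]

@[simp]
theorem inner_kerVec_right (x : X) (f : H) : ⟪f, kerVec H x⟫_ℂ = conj (f x) := by
  rw [← inner_conj_symm, inner_kerVec_left]

theorem kerVec_apply (x y : X) : kerVec H y x = ker H x y := RKHS.kerFun_apply H y 1 x

theorem conj_ker (x y : X) : conj (ker H x y) = ker H y x := by
  rw [← kerVec_apply, ← inner_kerVec_right, inner_kerVec_left, kerVec_apply]

/-- The adjoint of a contractive matrix of multipliers acts on kernel functions by the adjoints of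
the point values. -/
theorem sum_norm_sq_sum_kerVec_le {r : ℕ} {Φ : Matrix (Fin r) (Fin r) (Mult H)}
    (hΦ : ∀ h : Fin r → H, ∑ i, ‖∑ j, mulOp H (Φ i j) (h j)‖ ^ 2 ≤ ∑ j, ‖h j‖ ^ 2)
    {ι : Type*} [Fintype ι] (z : ι → X) (v : ι → Fin r → ℂ) :
    ∑ j, ‖∑ p, (∑ i, conj (Φ i j (z p)) * v p i) • kerVec H (z p)‖ ^ 2 ≤
      ∑ i, ‖∑ p, v p i • kerVec H (z p)‖ ^ 2 := by
  set G : Fin r → H := fun j => ∑ p, (∑ i, conj (Φ i j (z p)) * v p i) • kerVec H (z p) with hG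
  set F : Fin r → H := fun i => ∑ p, v p i • kerVec H (z p) with hF
  -- `G` is `Φ* F`. From `‖G‖² = ⟪F, Φ G⟫ ≤ ‖F‖ ‖Φ G‖ ≤ ‖F‖ ‖G‖` one factor cancels, so the adjoint
  -- need not be formed.
  have key : ((∑ j, ‖G j‖ ^ 2 : ℝ) : ℂ) = ∑ i, ⟪F i, ∑ j, mulOp H (Φ i j) (G j)⟫_ℂ := by
    have h1 : ∀ j, ((‖G j‖ ^ 2 : ℝ) : ℂ) =
        ∑ p, ∑ i, Φ i j (z p) * conj (v p i) * G j (z p) := by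
      intro j
      rw [ofReal_norm_sq]
      conv_lhs => rw [show ⟪G j, G j⟫_ℂ =
        ⟪∑ p, (∑ i, conj (Φ i j (z p)) * v p i) • kerVec H (z p), G j⟫_ℂ from rfl]
      simp only [sum_inner, inner_smul_left, inner_kerVec_left, map_sum, map_mul,
        Complex.conj_conj, Finset.sum_mul]
    have h2 : ∀ i, ⟪F i, ∑ j, mulOp H (Φ i j) (G j)⟫_ℂ =
        ∑ p, ∑ j, Φ i j (z p) * conj (v p i) * G j (z p) := by
      intro i
      simp only [hF, sum_inner, inner_smul_left, inner_sum, inner_kerVec_left, mulOp_apply]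
      rw [Finset.sum_comm]
      refine Finset.sum_congr rfl fun p _ => Finset.sum_congr rfl fun j _ => by ring
    rw [Complex.ofReal_sum, Finset.sum_congr rfl fun j _ => h1 j,
      Finset.sum_congr rfl fun i _ => h2 i, Finset.sum_comm]
    conv_rhs => rw [Finset.sum_comm]
    exact Finset.sum_congr rfl fun p _ => Finset.sum_comm
  set D : Fin r → H := fun i => ∑ j, mulOp H (Φ i j) (G j)
  have h3 : ∑ j, ‖G j‖ ^ 2 ≤ ∑ i, ‖F i‖ * ‖D i‖ := by
    have : ‖((∑ j, ‖G j‖ ^ 2 : ℝ) : ℂ)‖ ≤ ∑ i, ‖F i‖ * ‖D i‖ := by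
      rw [key]
      exact (norm_sum_le _ _).trans (Finset.sum_le_sum fun i _ => norm_inner_le_norm _ _)
    rwa [Complex.norm_of_nonneg (by positivity)] at this
  have h4 := Finset.sum_mul_sq_le_sq_mul_sq Finset.univ (fun i => ‖F i‖) (fun i => ‖D i‖)
  have h5 : ∑ i, ‖D i‖ ^ 2 ≤ ∑ j, ‖G j‖ ^ 2 := hΦ G
  have hg : 0 ≤ ∑ j, ‖G j‖ ^ 2 := by positivity
  have hf : 0 ≤ ∑ i, ‖F i‖ ^ 2 := by positivity
  change ∑ j, ‖G j‖ ^ 2 ≤ ∑ i, ‖F i‖ ^ 2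
  have h6 : (∑ j, ‖G j‖ ^ 2) ^ 2 ≤ (∑ i, ‖F i‖ ^ 2) * ∑ j, ‖G j‖ ^ 2 :=
    (pow_le_pow_left₀ hg h3 2).trans (h4.trans (mul_le_mul_of_nonneg_left h5 hf))
  rcases hg.eq_or_lt with h0 | h0
  · rwa [← h0]
  · rw [sq] at h6
    exact le_of_mul_le_mul_right h6 h0

variable (H) in
/-- The kernel functions compressed to the orthogonal complement of `k(·, y)`. -/
def kerVecOrth (y x : X) : H := (ℂ ∙ kerVec H y)ᗮ.starProjection (kerVec H x)

theorem kerVecOrth_self (y : X) : kerVecOrth H y y = 0 := by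
  rw [kerVecOrth, Submodule.starProjection_orthogonal']
  simp [Submodule.starProjection_eq_self_iff.2 (Submodule.mem_span_singleton_self (kerVec H y))]

theorem kerVecOrth_eq (y x : X) :
    kerVecOrth H y x = kerVec H x - (ker H y x / ker H y y) • kerVec H y := by
  rw [kerVecOrth, Submodule.starProjection_orthogonal']
  simp only [sub_apply, Submodule.starProjection_singleton]
  simp only [inner_kerVec_left, kerVec_apply]
  congr 3
  exact (ofReal_norm_sq _).trans (by rw [inner_kerVec_left, kerVec_apply])

theorem inner_kerVecOrth (y : X) (hy : ker H y y ≠ 0) (x x' : X) :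
    ⟪kerVecOrth H y x, kerVecOrth H y x'⟫_ℂ =
      ker H x x' - ker H x y * ker H y x' / ker H y y := by
  simp only [kerVecOrth_eq, inner_sub_left, inner_sub_right, inner_smul_left, inner_smul_right,
    inner_kerVec_left, kerVec_apply, map_div₀, conj_ker]
  field_simp
  ring

/-- The line through `k(·, y)` is invariant under adjoints of multipliers, so their compression to
its complement is still contractive and acts by the same point values. -/
theorem sum_norm_sq_sum_kerVecOrth_le {r n : ℕ} {Φ : Matrix (Fin r) (Fin r) (Mult H)}
    (hΦ : ∀ h : Fin r → H, ∑ i, ‖∑ j, mulOp H (Φ i j) (h j)‖ ^ 2 ≤ ∑ j, ‖h j‖ ^ 2)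
    (z : Fin n → X) (y : X) (v : Fin n → Fin r → ℂ) :
    ∑ j, ‖∑ p, (∑ i, conj (Φ i j (z p)) * v p i) • kerVecOrth H y (z p)‖ ^ 2 ≤
      ∑ i, ‖∑ p, v p i • kerVecOrth H y (z p)‖ ^ 2 := by
  set P := (ℂ ∙ kerVec H y)ᗮ.starProjection
  let z' : Option (Fin n) → X := fun o => o.elim y z
  -- The coefficient at the added point `y` makes the combination of kernel functions equal to its
  -- own projection; on the adjoint side the term at `y` is projected to zero.
  let v' : Option (Fin n) → Fin r → ℂ := fun o =>
    o.elim (fun i => -∑ p, v p i * (ker H y (z p) / ker H y y)) v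
  have h := sum_norm_sq_sum_kerVec_le hΦ z' v'
  have hr : ∀ i, ∑ p, v' p i • kerVec H (z' p) = ∑ p, v p i • kerVecOrth H y (z p) := by
    intro i
    simp only [Fintype.sum_option, kerVecOrth_eq, smul_sub, Finset.sum_sub_distrib, smul_smul,
      ← Finset.sum_smul]
    simp only [v', z', Option.elim_none, Option.elim_some, neg_smul]
    abel
  simp only [hr] at h
  refine le_trans (Finset.sum_le_sum fun j _ => ?_) h
  refine pow_le_pow_left₀ (norm_nonneg _) ?_ 2
  have hl : ∑ p, (∑ i, conj (Φ i j (z p)) * v p i) • kerVecOrth H y (z p) =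
      P (∑ p, (∑ i, conj (Φ i j (z' p)) * v' p i) • kerVec H (z' p)) := by
    rw [map_sum, Fintype.sum_option]
    simp only [map_smul]
    have : P (kerVec H (z' none)) = 0 := kerVecOrth_self y
    rw [this, smul_zero, zero_add]
    rfl
  rw [hl]
  exact Submodule.norm_starProjection_apply_le _ _

end Kernel

/-! ### From the Pick property to positivity of `1 - 1/k`. -/

section PickKernel

variable {X : Type*} {H : Type*} [NormedAddCommGroup H] [InnerProductSpace ℂ H] [CompleteSpace H]
  [RKHS ℂ H X ℂ]

open scoped Matrix in
/-- If a row contraction on the kernel functions at finitely many points is given, then it remains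
contractive after projecting to the orthogonal complement of another kernel function. -/
theorem IsCompletePick.posSemidef_kerVecOrth (hpick : IsCompletePick H) {r n : ℕ} (z : Fin n → X)
    (c : Fin n → Fin r → ℂ)
    (hc : (Matrix.of fun i j => ker H (z i) (z j) * (1 - ∑ l, c i l * conj (c j l))).PosSemidef)
    (y : X) :
    (Matrix.of fun i j => ⟪kerVecOrth H y (z i), kerVecOrth H y (z j)⟫_ℂ *
      (1 - ∑ l, c i l * conj (c j l))).PosSemidef := by
  -- The row `c i` is padded to a square matrix with top row `(0, c i)` and zeros below. The Pick
  -- matrix then splits into the block of `hc` at index `0` and copies of the kernel matrix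
  -- elsewhere.
  let W : Fin n → Matrix (Fin (r + 1)) (Fin (r + 1)) ℂ :=
    fun i => Matrix.of (Fin.cons (Fin.cons 0 (c i)) 0)
  have hW : ∀ i j a b, (W i * (W j)ᴴ) a b =
      if a = 0 ∧ b = 0 then ∑ l, c i l * conj (c j l) else 0 := by
    intro i j a b
    rw [Matrix.mul_apply]
    refine Fin.cases ?_ (fun a => ?_) a
    · refine Fin.cases ?_ (fun b => ?_) b
      · simp [W, Fin.sum_univ_succ, Matrix.conjTranspose_apply]
      · simp [W, Matrix.conjTranspose_apply]
    · simp [W]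
  let e : Fin (r + 1) → ℂ := fun a => if a = 0 then 1 else 0
  have he : (Matrix.diagonal e).PosSemidef := by
    refine Matrix.PosSemidef.diagonal fun a => ?_
    by_cases h : a = 0 <;> simp [e, h]
  have he' : (Matrix.diagonal (1 - e)).PosSemidef := by
    refine Matrix.PosSemidef.diagonal fun a => ?_
    by_cases h : a = 0 <;> simp [e, h]
  have hK : (Matrix.gram ℂ (kerVec H ∘ z)).PosSemidef := posSemidef_gram' _
  have hpsd := ((hc.submatrix (Prod.fst : Fin n × Fin (r + 1) → Fin n)).hadamard
    (he.submatrix Prod.snd)).add ((hK.submatrix (Prod.fst : Fin n × Fin (r + 1) → Fin n)).hadamard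
    (he'.submatrix Prod.snd))
  obtain ⟨Φ, hΦ, hΦW⟩ := hpick (r + 1) n z W (by
    refine Matrix.PosSemidef.of_entries_eq hpsd fun ⟨i, a⟩ ⟨j, b⟩ => ?_
    simp only [Matrix.of_apply, Matrix.sub_apply, hW, Matrix.add_apply, Matrix.hadamard_apply,
      Matrix.submatrix_apply, Matrix.gram_apply, Function.comp_apply, inner_kerVec_left,
      kerVec_apply, Matrix.diagonal_apply, Matrix.one_apply, e, Pi.sub_apply, Pi.one_apply]
    by_cases hab : a = b
    · subst hab
      by_cases ha : a = 0 <;> simp [ha]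
    · have : ¬ (a = 0 ∧ b = 0) := fun h => hab (h.1.trans h.2.symm)
      simp [hab, this])
  have := posSemidef_gram_sub_sum_gram (f := fun i => kerVecOrth H y (z i))
    (g := fun (l : Fin r) i => conj (c i l) • kerVecOrth H y (z i)) (fun s => by
      have h := sum_norm_sq_sum_kerVecOrth_le hΦ z y (fun p => Fin.cons (s p) 0)
      simp only [Fin.sum_univ_succ, hΦW] at h
      simp only [Matrix.of_apply, Fin.cons_zero, Fin.cons_succ, map_zero, Pi.zero_apply, mul_zero,
        zero_mul, zero_smul, Finset.sum_const_zero, norm_zero, W, add_zero, zero_add, ne_eq,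
        OfNat.ofNat_ne_zero, not_false_eq_true, zero_pow] at h
      simp only [zero_smul, implies_true, smul_smul, zero_mul, Finsupp.sum_fintype]
      simpa only [mul_comm (s _)] using h)
  refine Matrix.PosSemidef.of_entries_eq this fun i j => ?_
  simp only [Matrix.of_apply, Matrix.sub_apply, Matrix.sum_apply, Matrix.gram_apply,
    inner_smul_left, inner_smul_right, Complex.conj_conj, mul_sub, mul_one, Finset.mul_sum]
  congr 1
  exact Finset.sum_congr rfl fun l _ => by ring

theorem ker_self_ne_zero (hnorm : IsNormalized H) (x : X) : ker H x x ≠ 0 := by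
  obtain ⟨x₀, h₀⟩ := hnorm
  intro h
  have h1 : kerVec H x = 0 := by
    rw [← inner_self_eq_zero (𝕜 := ℂ), inner_kerVec_left, kerVec_apply, h]
  have h2 := h₀ x
  rw [← kerVec_apply, ← inner_kerVec_left, h1, inner_zero_left] at h2
  exact zero_ne_one h2

/-- If `k(x,y) = 0`, the values `1, -1` at `x, y` have zero Pick matrix. Compressing off `k(·, x₀) =
1` replaces `k` by `k - 1`, giving diagonal `0` and off-diagonal entries `-2`, which is not
positive. -/
theorem IsCompletePick.ker_ne_zero (hpick : IsCompletePick H) (hnorm : IsNormalized H) (x y : X) :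
    ker H x y ≠ 0 := by
  intro h
  have h' : ker H y x = 0 := by rw [← conj_ker, h, map_zero]
  have hker := ker_self_ne_zero hnorm
  obtain ⟨x₀, h₀⟩ := hnorm
  have h₀' : ∀ x, ker H x₀ x = 1 := fun x => by rw [← conj_ker, h₀, map_one]
  have := hpick.posSemidef_kerVecOrth (r := 1) ![x, y] (fun i _ => ![1, -1] i) (by
    refine Matrix.PosSemidef.of_entries_eq Matrix.PosSemidef.zero fun i j => ?_
    fin_cases i <;> fin_cases j <;> simp [h, h']) x₀
  have h2 := this.dotProduct_mulVec_nonneg ![1, 1]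
  simp [dotProduct, Matrix.mulVec, Fin.sum_univ_two, inner_kerVecOrth x₀ (hker x₀), h, h', h₀,
    h₀'] at h2
  norm_num [Complex.le_def] at h2

/-- The necessity part of the McCullough–Quiggin characterization of complete Pick kernels,
for finitely many points. -/
theorem IsCompletePick.posSemidef_one_sub_div (hpick : IsCompletePick H)
    (hker : ∀ x y : X, ker H x y ≠ 0) {n : ℕ} (z : Fin n → X) (y : X) :
    (Matrix.of fun i j => 1 - ker H (z i) y * ker H y (z j) /
      (ker H (z i) (z j) * ker H y y)).PosSemidef := by
  induction n generalizing y with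
  | zero =>
    exact Matrix.PosSemidef.of_entries_eq Matrix.PosSemidef.zero fun i => i.elim0
  | succ n ih =>
    have hpos : ∀ x : X, 0 ≤ (ker H x x)⁻¹ := by
      intro x
      rw [← kerVec_apply, ← inner_kerVec_left, ← ofReal_norm_sq, ← Complex.ofReal_inv]
      exact_mod_cast inv_nonneg.2 (sq_nonneg _)
    -- With base point `z 0`, the row and column at `0` vanish, so the induction hypothesis on the
    -- other `n` points gives positivity. This is why `y` is generalized.
    set M : Matrix (Fin (n + 1)) (Fin (n + 1)) ℂ := Matrix.of fun i j =>
      1 - ker H (z i) (z 0) * ker H (z 0) (z j) / (ker H (z i) (z j) * ker H (z 0) (z 0)) with hM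
    have hMpsd : M.PosSemidef := by
      have h1 := ih (fun i => z i.succ) (z 0)
      have h0 : ∀ j, M 0 j = 0 := fun j => by
        have := hker (z 0) (z 0)
        have := hker (z 0) (z j)
        simp only [hM, Matrix.of_apply]
        field_simp
        simp
      have h0' : ∀ j, M j 0 = 0 := fun j => by
        have := hker (z 0) (z 0)
        have := hker (z j) (z 0)
        simp only [hM, Matrix.of_apply]
        field_simp
        simp
      have hherm : M.IsHermitian := by
        ext i j
        simp [hM, Matrix.conjTranspose_apply, conj_ker, mul_comm]
      refine Matrix.PosSemidef.of_dotProduct_mulVec_nonneg hherm fun x => ?_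
      have h2 := h1.dotProduct_mulVec_nonneg (fun i => x i.succ)
      convert h2 using 1
      simp only [dotProduct, Matrix.mulVec, Fin.sum_univ_succ, h0, h0', zero_mul,
        Finset.sum_const_zero, mul_zero, zero_add]
      rfl
    obtain ⟨m, v, hv⟩ := Matrix.posSemidef_iff_eq_sum_vecMulVec.1 hMpsd
    have hsum : ∀ i j, 1 - ∑ l, v l i * conj (v l j) =
        ker H (z i) (z 0) * ker H (z 0) (z j) / (ker H (z i) (z j) * ker H (z 0) (z 0)) := by
      intro i j
      have : M i j = ∑ l, v l i * conj (v l j) := by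
        conv_lhs => rw [hv]
        simp [Matrix.sum_apply, Matrix.vecMulVec_apply]
      rw [← this, hM, Matrix.of_apply]
      ring
    -- For the row given by a factorization of `M`, the Pick matrix collapses to a positive multiple
    -- of a rank-one matrix built from `k(·, z 0)`. After compression off `k(·, y)`, a Schur product
    -- cancels the factors involving `z 0`.
    have h := hpick.posSemidef_kerVecOrth z (fun i l => v l i) (by
      refine Matrix.PosSemidef.of_entries_eq ((Matrix.posSemidef_vecMulVec_self_star
        fun i => ker H (z i) (z 0)).smul (hpos (z 0))) fun i j => ?_
      have := hker (z i) (z j)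
      have := hker (z 0) (z 0)
      simp only [Matrix.of_apply, hsum, Matrix.smul_apply, Matrix.vecMulVec_apply, Pi.star_apply,
        Complex.star_def, conj_ker, smul_eq_mul]
      field_simp) y
    have h3 := h.hadamard ((Matrix.posSemidef_vecMulVec_self_star
      fun i => (ker H (z i) (z 0))⁻¹).smul (inv_nonneg.1 (by simpa using hpos (z 0)) :
        (0 : ℂ) ≤ ker H (z 0) (z 0)))
    refine Matrix.PosSemidef.of_entries_eq h3 fun i j => ?_
    have := hker (z i) (z j)
    have := hker (z 0) (z 0)
    have := hker y y
    have := hker (z i) (z 0)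
    have := hker (z 0) (z j)
    simp only [Matrix.of_apply, hsum, Matrix.smul_apply, Matrix.vecMulVec_apply, Pi.star_apply,
        Complex.star_def, conj_ker, smul_eq_mul, Matrix.hadamard_apply,
        inner_kerVecOrth y (hker y y), map_inv₀]
    field_simp

/-- A normalized complete Pick kernel `k` satisfies `1 - 1 / k ≥ 0`. -/
theorem IsCompletePick.posSemidef_one_sub_inv (hpick : IsCompletePick H)
    (hker : ∀ x y : X, ker H x y ≠ 0) {x₀ : X} (h₀ : ∀ x : X, ker H x x₀ = 1) :
    (Matrix.of fun x y : X => 1 - (ker H x y)⁻¹).PosSemidef := by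
  have h₀' : ∀ x, ker H x₀ x = 1 := fun x => by rw [← conj_ker, h₀, map_one]
  refine ⟨?_, fun s => ?_⟩
  · ext x y
    simp [conj_ker]
  · let e := s.support.equivFin
    have h := hpick.posSemidef_one_sub_div hker (fun i => (e.symm i : X)) x₀
    have h2 := h.dotProduct_mulVec_nonneg (fun i => s (e.symm i))
    convert h2 using 1
    simp only [Finsupp.sum, dotProduct, Matrix.mulVec, Matrix.of_apply, h₀, h₀', Pi.star_apply,
      Finset.mul_sum, mul_one, one_div]
    rw [← Finset.sum_coe_sort, ← e.symm.sum_comp]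
    refine Finset.sum_congr rfl fun i _ => ?_
    rw [← Finset.sum_coe_sort, ← e.symm.sum_comp]
    exact Finset.sum_congr rfl fun j _ => by ring

end PickKernel

-- Feature maps of positive kernels.

universe u

/-- A positive semidefinite scalar kernel has a feature map into an inner product space. -/
theorem exists_inner_eq_of_posSemidef {X : Type u} {B : Matrix X X ℂ} (hB : B.PosSemidef) :
    ∃ (E : Type u) (_ : NormedAddCommGroup E) (_ : InnerProductSpace ℂ E) (b : X → E),
      ∀ x y, ⟪b x, b y⟫_ℂ = B x y := by
  let K : Matrix X X (ℂ →L[ℂ] ℂ) := Matrix.of fun x y => B x y • 1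
  have hK : K.PosSemidef := by
    have htfae := (RKHS.posSemidef_tfae (K := K)).out 0 2
    refine htfae.mpr ⟨?_, fun v => ?_⟩
    · ext x y
      have := hB.1.apply x y
      simpa [K, Matrix.conjTranspose_apply] using this
    · have h := (Complex.le_def.1 (hB.2 v)).1
      have heq : (v.sum fun x w => v.sum fun x' w' => ⟪K x' x w, w'⟫_ℂ) =
          v.sum fun x w => v.sum fun x' w' => star w * B x x' * w' := by
        refine Finset.sum_congr rfl fun x _ => Finset.sum_congr rfl fun y _ => ?_
        have := hB.1.apply x y
        simp [K, ← this]
        ring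
      rw [heq]
      exact h
  have : Fact K.PosSemidef := ⟨hK⟩
  refine ⟨RKHS.OfKernel K, inferInstance, inferInstance,
    fun x => RKHS.kerFun (RKHS.OfKernel K) x 1, fun x y => ?_⟩
  rw [RKHS.kerFun_inner, RKHS.kerFun_apply, RKHS.OfKernel.kernel_ofKernel]
  simp [K]

/-! ### The row contraction attached to `1 - 1/k` and the multipliers it produces. -/

section Row

variable {X : Type*} {H : Type*} [NormedAddCommGroup H] [InnerProductSpace ℂ H] [CompleteSpace H]
  [RKHS ℂ H X ℂ]

theorem denseRange_linearCombination_kerVec :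
    DenseRange (Finsupp.linearCombination ℂ (kerVec H : X → H)) := by
  have h : Dense ((Submodule.span ℂ (Set.range (kerVec H : X → H)) : Submodule ℂ H) : Set H) := by
    rw [Submodule.dense_iff_topologicalClosure_eq_top, Submodule.topologicalClosure_eq_top_iff,
      Submodule.eq_bot_iff]
    intro f hf
    refine DFunLike.ext f 0 fun x => ?_
    rw [← inner_kerVec_left]
    simpa using Submodule.inner_right_of_mem_orthogonal
      (Submodule.subset_span (Set.mem_range_self x)) hf
  rwa [← Finsupp.range_linearCombination, LinearMap.coe_range] at h

/-- A function belongs to `H`, with norm at most `C`, if the functional that it induces on the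
span of the kernel functions is bounded by `C`. -/
theorem exists_coe_eq_of_bound (g : X → ℂ) {C : ℝ} (hC : 0 ≤ C)
    (h : ∀ s : X →₀ ℂ, ‖s.sum fun x a => a * conj (g x)‖ ≤ C * ‖s.sum fun x a => a • kerVec H x‖) :
    ∃ f : H, (∀ x, f x = g x) ∧ ‖f‖ ≤ C := by
  let e := Finsupp.linearCombination ℂ (kerVec H : X → H)
  let l := Finsupp.linearCombination ℂ (fun x => conj (g x))
  have hl : ∀ s, ‖l s‖ ≤ C * ‖e s‖ := fun s => by
    simpa [l, e, Finsupp.linearCombination_apply] using h s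
  have hd : DenseRange e := denseRange_linearCombination_kerVec
  refine ⟨(InnerProductSpace.toDual ℂ H).symm (l.extendOfNorm e), fun x => ?_, ?_⟩
  · have hx := LinearMap.extendOfNorm_eq hd ⟨C, hl⟩ (Finsupp.single x 1)
    rw [← InnerProductSpace.toDual_symm_apply] at hx
    simp only [e, l, Finsupp.linearCombination_single, one_smul, inner_kerVec_right] at hx
    exact (starRingEnd ℂ).injective hx
  · rw [LinearIsometryEquiv.norm_map]
    exact LinearMap.opNorm_extendOfNorm_le hd hC hl

/-- Positivity says that `k(·,x) ↦ conj (θ x) • k(·,x)` is contractive on the span of the kernel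
functions; its adjoint is multiplication by `θ`. -/
theorem mem_multiplierAlgebra_of_posSemidef {θ : X → ℂ}
    (hθ : (Matrix.of fun z w => ker H z w * (1 - θ z * conj (θ w))).PosSemidef) :
    θ ∈ multiplierAlgebra H := by
  intro f
  have hpsd : (Matrix.gram ℂ (kerVec H) -
      Matrix.gram ℂ fun x => conj (θ x) • kerVec H x).PosSemidef := by
    refine hθ.of_entries_eq fun z w => ?_
    simp only [Matrix.sub_apply, Matrix.gram_apply, Matrix.of_apply, inner_smul_left,
      inner_smul_right, inner_kerVec_left, kerVec_apply, Complex.conj_conj]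
    ring
  obtain ⟨g, hg, -⟩ := exists_coe_eq_of_bound (H := H) (θ * ⇑f) (norm_nonneg f) fun s => by
    have h1 : (s.sum fun x a => a * conj ((θ * ⇑f) x)) =
        ⟪f, s.sum fun x a => a • conj (θ x) • kerVec H x⟫_ℂ := by
      simp only [Finsupp.sum, inner_sum, inner_smul_right, inner_kerVec_right, Pi.mul_apply,
        map_mul]
    rw [h1]
    exact (norm_inner_le_norm _ _).trans (mul_le_mul_of_nonneg_left
      (norm_le_of_posSemidef_gram_sub_gram hpsd s) (norm_nonneg f))
  exact ⟨g, funext hg⟩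

variable {T : Type*} [NormedAddCommGroup T] [InnerProductSpace ℂ T] {τ : X → H → T}

/-- Row contractivity of a feature map `b` of the kernel `1 - 1 / k`, where `τ x f` plays the role
of the elementary tensor `b(x) ⊗ f`. -/
theorem exists_apply_eq_inner (hker : ∀ x y : X, ker H x y ≠ 0)
    (hτ : ∀ x y f g, ⟪τ x f, τ y g⟫_ℂ = (1 - (ker H x y)⁻¹) * ⟪f, g⟫_ℂ)
    (t : T) : ∃ g : H, (∀ x, g x = ⟪τ x (kerVec H x), t⟫_ℂ) ∧ ‖g‖ ≤ ‖t‖ := by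
  refine exists_coe_eq_of_bound _ (norm_nonneg t) fun s => ?_
  have h1 : (s.sum fun x a => a * conj ⟪τ x (kerVec H x), t⟫_ℂ) =
      ⟪t, s.sum fun x a => a • τ x (kerVec H x)⟫_ℂ := by
    simp only [Finsupp.sum, inner_sum, inner_smul_right, inner_conj_symm]
  have hpsd : (Matrix.gram ℂ (kerVec H) -
      Matrix.gram ℂ fun x => τ x (kerVec H x)).PosSemidef := by
    -- The difference is `k - (1 - 1/k) k = 1`, a rank-one Gram matrix.
    refine (posSemidef_gram' fun _ : X => (1 : ℂ)).of_entries_eq fun z w => ?_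
    simp only [Matrix.sub_apply, Matrix.gram_apply, hτ, inner_kerVec_left, kerVec_apply,
      RCLike.inner_apply, map_one, mul_one]
    linear_combination mul_inv_cancel₀ (hker z w)
  rw [h1]
  exact (norm_inner_le_norm _ _).trans (mul_le_mul_of_nonneg_left
      (norm_le_of_posSemidef_gram_sub_gram hpsd s) (norm_nonneg t))

theorem one_sub_inv_ker_mem_multiplierAlgebra (hker : ∀ x y : X, ker H x y ≠ 0)
    (hτ : ∀ x y f g, ⟪τ x f, τ y g⟫_ℂ = (1 - (ker H x y)⁻¹) * ⟪f, g⟫_ℂ) (w : X) :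
    (fun x => 1 - (ker H x w)⁻¹) ∈ multiplierAlgebra H := by
  intro f
  obtain ⟨g, hg, -⟩ := exists_apply_eq_inner hker hτ (τ w f)
  refine ⟨g, funext fun x => ?_⟩
  simp [hg, hτ]

/-- Multiplication by `1 - 1 / k(·, w)`. -/
def mulOneSubInvKer (hker : ∀ x y : X, ker H x y ≠ 0)
    (hτ : ∀ x y f g, ⟪τ x f, τ y g⟫_ℂ = (1 - (ker H x y)⁻¹) * ⟪f, g⟫_ℂ) (w : X) : H →L[ℂ] H :=
  mulOp H ⟨fun x => 1 - (ker H x w)⁻¹, one_sub_inv_ker_mem_multiplierAlgebra hker hτ w⟩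

theorem mulOneSubInvKer_apply (hker : ∀ x y : X, ker H x y ≠ 0)
    (hτ : ∀ x y f g, ⟪τ x f, τ y g⟫_ℂ = (1 - (ker H x y)⁻¹) * ⟪f, g⟫_ℂ) (w : X) (f : H) (x : X) :
    mulOneSubInvKer hker hτ w f x = (1 - (ker H x w)⁻¹) * f x := mulOp_apply _ f x

/-- The operator sends `f` to the row operator applied to `τ w f`, and `‖τ w f‖² = (1 - 1/k(w,w))
‖f‖²`. -/
theorem norm_mulOneSubInvKer_lt_one (hker : ∀ x y : X, ker H x y ≠ 0)
    (hτ : ∀ x y f g, ⟪τ x f, τ y g⟫_ℂ = (1 - (ker H x y)⁻¹) * ⟪f, g⟫_ℂ) (w : X) :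
    ‖mulOneSubInvKer hker hτ w‖ < 1 := by
  set c : ℝ := 1 - (‖kerVec H w‖ ^ 2)⁻¹ with hc
  have hk : ((‖kerVec H w‖ ^ 2 : ℝ) : ℂ) = ker H w w := by
    rw [ofReal_norm_sq, inner_kerVec_left, kerVec_apply]
  have hc1 : c < 1 := by
    have h0 : kerVec H w ≠ 0 := fun h => hker w w (by rw [← hk, h]; simp)
    have : 0 < (‖kerVec H w‖ ^ 2)⁻¹ := by positivity
    linarith
  refine lt_of_le_of_lt (ContinuousLinearMap.opNorm_le_bound _ (Real.sqrt_nonneg c) fun f => ?_)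
    ((Real.sqrt_lt' one_pos).2 (by simpa using hc1))
  obtain ⟨g, hg, hgn⟩ := exists_apply_eq_inner hker hτ (τ w f)
  have h1 : mulOneSubInvKer hker hτ w f = g := DFunLike.ext _ _ fun x => by
    simp [hg, hτ, mulOneSubInvKer_apply]
  have h2 : ‖τ w f‖ ^ 2 = c * ‖f‖ ^ 2 := by
    have : ((‖τ w f‖ ^ 2 : ℝ) : ℂ) = ((c * ‖f‖ ^ 2 : ℝ) : ℂ) := by
      rw [ofReal_norm_sq, hτ, Complex.ofReal_mul, ofReal_norm_sq, hc, Complex.ofReal_sub,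
        Complex.ofReal_inv, hk, Complex.ofReal_one]
    exact_mod_cast this
  have h3 : ‖τ w f‖ = √c * ‖f‖ := by
    rw [← Real.sqrt_sq (norm_nonneg (τ w f)), h2, Real.sqrt_mul' _ (sq_nonneg _),
      Real.sqrt_sq (norm_nonneg f)]
  rw [h1, ← h3]
  exact hgn

/-- The row contraction maps `τ w (y w)` to the vector in the second Gram matrix. -/
theorem posSemidef_gram_sub_gram_mulOneSubInvKer (hker : ∀ x y : X, ker H x y ≠ 0)
    (hτ : ∀ x y f g, ⟪τ x f, τ y g⟫_ℂ = (1 - (ker H x y)⁻¹) * ⟪f, g⟫_ℂ) (y : X → H) :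
    (Matrix.gram ℂ (fun w => τ w (y w)) -
      Matrix.gram ℂ fun w => mulOneSubInvKer hker hτ w (y w)).PosSemidef := by
  refine posSemidef_gram_sub_gram fun s => ?_
  obtain ⟨g, hg, hgn⟩ := exists_apply_eq_inner hker hτ (s.sum fun w a => a • τ w (y w))
  have : (s.sum fun w a => a • mulOneSubInvKer hker hτ w (y w)) = g := DFunLike.ext _ _ fun x => by
    rw [← inner_kerVec_left, hg]
    simp [Finsupp.sum, hτ, mulOneSubInvKer_apply]
  rwa [this]

/-- With `C w = mulOneSubInvKer hker hτ w`, the kernel `k (⟪y z, y w⟫ - ⟪C z (y z), C w (y w)⟫)`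
equals the Gram matrix of `y` plus the Schur product of `k` with the positive difference of the
preceding lemma. -/
theorem mem_multiplierAlgebra_of_inner (hker : ∀ x y : X, ker H x y ≠ 0)
    (hτ : ∀ x y f g, ⟪τ x f, τ y g⟫_ℂ = (1 - (ker H x y)⁻¹) * ⟪f, g⟫_ℂ)
    {θ : X → ℂ} (y : X → H)
    (hθ : ∀ z w, 1 - θ z * conj (θ w) =
      ⟪y z, y w⟫_ℂ - ⟪mulOneSubInvKer hker hτ z (y z), mulOneSubInvKer hker hτ w (y w)⟫_ℂ) :
    θ ∈ multiplierAlgebra H := by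
  refine mem_multiplierAlgebra_of_posSemidef ?_
  refine ((posSemidef_gram' y).add ((posSemidef_gram' (kerVec H)).hadamard
    (posSemidef_gram_sub_gram_mulOneSubInvKer hker hτ y))).of_entries_eq fun z w => ?_
  simp only [Matrix.of_apply, hθ, Matrix.add_apply, Matrix.hadamard_apply, Matrix.sub_apply,
    Matrix.gram_apply, inner_kerVec_left, kerVec_apply, hτ]
  linear_combination ⟪y z, y w⟫_ℂ * mul_inv_cancel₀ (hker z w)

/-- Multiplication by the kernel function `k(·, w)`, as the inverse of multiplication by
`1 / k(·, w)`. -/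
def mulKer (hker : ∀ x y : X, ker H x y ≠ 0)
    (hτ : ∀ x y f g, ⟪τ x f, τ y g⟫_ℂ = (1 - (ker H x y)⁻¹) * ⟪f, g⟫_ℂ) (w : X) : H →L[ℂ] H :=
  ↑(Units.oneSub (mulOneSubInvKer hker hτ w) (norm_mulOneSubInvKer_lt_one hker hτ w))⁻¹

theorem mulKer_sub (hker : ∀ x y : X, ker H x y ≠ 0)
    (hτ : ∀ x y f g, ⟪τ x f, τ y g⟫_ℂ = (1 - (ker H x y)⁻¹) * ⟪f, g⟫_ℂ) (w : X) (f : H) :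
    mulOneSubInvKer hker hτ w (mulKer hker hτ w f) = mulKer hker hτ w f - f := by
  have h := (Units.oneSub (mulOneSubInvKer hker hτ w)
    (norm_mulOneSubInvKer_lt_one hker hτ w)).mul_inv
  have h' : mulKer hker hτ w f - mulOneSubInvKer hker hτ w (mulKer hker hτ w f) = f :=
    DFunLike.congr_fun h f
  rw [eq_sub_iff_add_eq, ← eq_sub_iff_add_eq']
  exact h'.symm

theorem mulKer_apply (hker : ∀ x y : X, ker H x y ≠ 0)
    (hτ : ∀ x y f g, ⟪τ x f, τ y g⟫_ℂ = (1 - (ker H x y)⁻¹) * ⟪f, g⟫_ℂ) (w : X) (f : H) (x : X) :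
    mulKer hker hτ w f x = ker H x w * f x := by
  have h := congrArg (fun g : H => g x) (mulKer_sub hker hτ w f)
  simp only [mulOneSubInvKer_apply, RKHS.coe_sub, Pi.sub_apply] at h
  linear_combination -ker H x w * h - mulKer hker hτ w f x * mul_inv_cancel₀ (hker x w)

/-- For `g = k(·,w) f` one has `f = g - C g` with `‖C‖ < 1`; `⟪g, f⟫ = 0` would give `‖g‖² = ⟪g, C
g⟫`, hence `g = 0` and `f = 0`. -/
theorem inner_mulKer_self_ne_zero (hker : ∀ x y : X, ker H x y ≠ 0)
    (hτ : ∀ x y f g, ⟪τ x f, τ y g⟫_ℂ = (1 - (ker H x y)⁻¹) * ⟪f, g⟫_ℂ) (w : X)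
    {f : H} (hf : f ≠ 0) : ⟪mulKer hker hτ w f, f⟫_ℂ ≠ 0 := by
  intro h
  set g := mulKer hker hτ w f with hg
  have hC : mulOneSubInvKer hker hτ w g = g - f := mulKer_sub hker hτ w f
  have h1 : ⟪g, mulOneSubInvKer hker hτ w g⟫_ℂ = ⟪g, g⟫_ℂ := by rw [hC, inner_sub_right, h, sub_zero]
  by_cases hg0 : g = 0
  · rw [hg0, map_zero, zero_sub] at hC
    exact hf (neg_eq_zero.1 hC.symm)
  have h2 : ‖g‖ ^ 2 ≤ ‖g‖ * ‖mulOneSubInvKer hker hτ w g‖ := by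
    have := norm_inner_le_norm (𝕜 := ℂ) g (mulOneSubInvKer hker hτ w g)
    rwa [h1, ← ofReal_norm_sq, Complex.norm_of_nonneg (by positivity)] at this
  have h3 : ‖mulOneSubInvKer hker hτ w g‖ < ‖g‖ :=
    ((mulOneSubInvKer hker hτ w).le_opNorm g).trans_lt
      (mul_lt_of_lt_one_left (norm_pos_iff.2 hg0) (norm_mulOneSubInvKer_lt_one hker hτ w))
  nlinarith [norm_pos_iff.2 hg0]

/-- Every `f ∈ H` of norm one is the quotient of the multipliers `f / u` and `1 / u`, where
`u(z) = ⟨f, k(·, z) f⟩`. -/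
theorem exists_multiplier_quotient (hker : ∀ x y : X, ker H x y ≠ 0)
    (hτ : ∀ x y f g, ⟪τ x f, τ y g⟫_ℂ = (1 - (ker H x y)⁻¹) * ⟪f, g⟫_ℂ) {x₀ : X}
    (h₀ : ∀ x : X, ker H x x₀ = 1) {f : H} (hf : ‖f‖ = 1) :
    ∃ η ∈ multiplierAlgebra H, (∀ x, η x ≠ 0) ∧ (f : X → ℂ) * η ∈ multiplierAlgebra H := by
  have hf0 : f ≠ 0 := fun h => by simp [h] at hf
  have hff : ⟪f, f⟫_ℂ = 1 := by rw [← ofReal_norm_sq, hf]; simp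
  set u : X → ℂ := fun z => ⟪mulKer hker hτ z f, f⟫_ℂ with hu
  have hu0 : ∀ z, u z ≠ 0 := fun z => inner_mulKer_self_ne_zero hker hτ z hf0
  have huc : ∀ z, conj (u z) = ⟪f, mulKer hker hτ z f⟫_ℂ := fun z => inner_conj_symm _ _
  have hη : (fun z => 1 - (u z)⁻¹) ∈ multiplierAlgebra H := by
    -- Since `C w` sends `k(·,w) f` to `k(·,w) f - f`, the difference of inner products is `(u z +
    -- conj (u w) - 1) / (u z * conj (u w))`, which is `1 - θ z * conj (θ w)` for `θ = 1 - 1/u`.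
    refine mem_multiplierAlgebra_of_inner hker hτ (fun w => (conj (u w))⁻¹ • mulKer hker hτ w f)
      fun z w => ?_
    have := hu0 z
    have hl : ∀ z, ⟪mulKer hker hτ z f, f⟫_ℂ = u z := fun z => rfl
    simp only [map_smul, mulKer_sub, inner_smul_left, inner_smul_right, inner_sub_left,
      inner_sub_right, hff, map_sub, map_one, map_inv₀, Complex.conj_conj, ← huc, hl]
    have : conj (u w) ≠ 0 := (map_ne_zero _).2 (hu0 w)
    field_simp
    ring
  refine ⟨fun z => (u z)⁻¹, ?_, fun z => inv_ne_zero (hu0 z), ?_⟩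
  · have := sub_mem (one_mem (multiplierAlgebra H)) hη
    convert this using 1
    ext z
    simp
  · set φ : X → ℂ := fun z => f z * (u z)⁻¹ with hφ
    change φ ∈ multiplierAlgebra H
    set e : H := kerVec H x₀ with he
    have he1 : ∀ x, e x = 1 := fun x => by rw [he, kerVec_apply, h₀]
    have hke : ∀ w, mulKer hker hτ w e = kerVec H w := fun w => DFunLike.ext _ _ fun x => by
      rw [mulKer_apply, he1, kerVec_apply, mul_one]
    -- Division by `u` makes `q w` orthogonal to `f`. In `C q + e = q + conj φ • f` both sides are
    -- orthogonal sums, as `1 - 1/k(·,w)` vanishes at `x₀` and `e = k(·,x₀)`. Comparing inner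
    -- products gives the required identity.
    set q : X → H := fun w => mulKer hker hτ w (e - conj (φ w) • f) with hq
    have hqf : ∀ w, ⟪q w, f⟫_ℂ = 0 := fun w => by
      have := hu0 w
      simp only [hq, map_sub, map_smul, hke, inner_sub_left, inner_smul_left, inner_kerVec_left,
        Complex.conj_conj]
      change f w - φ w * u w = 0
      simp only [hφ]
      field_simp
      ring
    have hfq : ∀ w, ⟪f, q w⟫_ℂ = 0 := fun w => by rw [← inner_conj_symm, hqf, map_zero]
    have hC : ∀ w, mulOneSubInvKer hker hτ w (q w) + e = q w + conj (φ w) • f := fun w => by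
      simp only [hq, mulKer_sub]
      abel
    have hee : ⟪e, e⟫_ℂ = 1 := by rw [he, inner_kerVec_left, kerVec_apply, h₀]
    have heC : ∀ w h, ⟪e, mulOneSubInvKer hker hτ w h⟫_ℂ = 0 := fun w h => by
      rw [he, inner_kerVec_left, mulOneSubInvKer_apply, ← conj_ker, h₀, map_one, inv_one, sub_self,
        zero_mul]
    have hCe : ∀ w h, ⟪mulOneSubInvKer hker hτ w h, e⟫_ℂ = 0 := fun w h => by
      rw [← inner_conj_symm, heC, map_zero]
    refine mem_multiplierAlgebra_of_inner hker hτ q fun z w => ?_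
    have h1 : ⟪mulOneSubInvKer hker hτ z (q z) + e, mulOneSubInvKer hker hτ w (q w) + e⟫_ℂ =
        ⟪q z + conj (φ z) • f, q w + conj (φ w) • f⟫_ℂ := by rw [hC, hC]
    simp only [inner_add_left, inner_add_right, inner_smul_left, inner_smul_right, hqf, hfq, hee,
      heC, hCe, hff, Complex.conj_conj] at h1
    linear_combination h1

end Row

/-- In a normalized complete Pick space, every function is a quotient of two multipliers, with a
denominator that has no zeros. -/
theorem IsCompletePick.exists_multiplier_quotient {X : Type*} {H : Type*} [NormedAddCommGroup H]
    [InnerProductSpace ℂ H] [CompleteSpace H] [RKHS ℂ H X ℂ] (hpick : IsCompletePick H)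
    (hnorm : IsNormalized H) (f : H) :
    ∃ η ∈ multiplierAlgebra H, (∀ x, η x ≠ 0) ∧ (f : X → ℂ) * η ∈ multiplierAlgebra H := by
  by_cases hf : f = 0
  · refine ⟨1, one_mem _, fun x => one_ne_zero, ?_⟩
    rw [hf, RKHS.coe_zero, zero_mul]
    exact zero_mem _
  have hker := hpick.ker_ne_zero hnorm
  obtain ⟨x₀, h₀⟩ := hnorm
  -- The tensors `b x ⊗ f` come from a single feature map on `X × H`, for the Schur product of `1 -
  -- 1/k` with the inner product of `H`.
  have hpsd := ((hpick.posSemidef_one_sub_inv hker h₀).submatrix (Prod.fst : X × H → X)).hadamard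
    ((posSemidef_gram' (fun f : H => f)).submatrix (Prod.snd : X × H → H))
  obtain ⟨T, _, _, t, ht⟩ := exists_inner_eq_of_posSemidef hpsd
  obtain ⟨η, hη, hη0, hfη⟩ := PickSpace.exists_multiplier_quotient
    (τ := fun x f => t (x, f)) hker (fun x y f g => ht (x, f) (y, g)) h₀
    (norm_smul_inv_norm (𝕜 := ℂ) hf)
  refine ⟨η, hη, hη0, ?_⟩
  have h1 := (multiplierAlgebra H).smul_mem hfη (‖f‖ : ℂ)
  convert h1 using 1
  have : (‖f‖ : ℂ) ≠ 0 := by exact_mod_cast norm_ne_zero_iff.2 hf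
  ext x
  simp [RKHS.coe_smul]
  field_simp

/-- A non-invertible element of a commutative complex Banach algebra is annihilated by a
character. -/
theorem exists_character_apply_eq_zero {A : Type*} [inst : SeminormedCommRing A]
    [NormedAlgebra ℂ A] [CompleteSpace A] (h0 : ∀ a : A, ‖a‖ = 0 → a = 0) {a : A}
    (ha : ¬ IsUnit a) : ∃ χ : WeakDual.characterSpace ℂ A, χ a = 0 := by
  let _ : NormedCommRing A :=
    { inst with
      eq_of_dist_eq_zero := fun {x y} h => by
        rw [dist_eq_norm_sub] at h
        exact sub_eq_zero.1 (h0 _ h) }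
  exact WeakDual.CharacterSpace.exists_apply_eq_zero ha

/-! ### `Mult H` as a Banach algebra and its characters. -/

section Mult

variable {X : Type*} {H : Type*} [NormedAddCommGroup H] [InnerProductSpace ℂ H] [CompleteSpace H]
  [RKHS ℂ H X ℂ]

theorem isUniformInducing_mulOp : IsUniformInducing (mulOp H : Mult H → H →L[ℂ] H) := ⟨rfl⟩

theorem mulOp_apply_of_eq_one {e : H} (he : ∀ x, e x = 1) (φ : Mult H) (x : X) :
    mulOp H φ e x = φ x := by
  rw [mulOp_apply, he, mul_one]

theorem Mult.eq_zero_of_norm_eq_zero {e : H} (he : ∀ x, e x = 1) {φ : Mult H} (h : ‖φ‖ = 0) :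
    φ = 0 := by
  rw [Mult.norm_eq, norm_eq_zero] at h
  refine DFunLike.ext φ 0 fun x => ?_
  rw [← mulOp_apply_of_eq_one he φ, h, zero_apply, RKHS.coe_zero]
  rfl

/-- The multiplication operators are exactly the `T` with `T f = (T e) f` pointwise, a closed
condition because evaluations are continuous. -/
theorem Mult.completeSpace {e : H} (he : ∀ x, e x = 1) : CompleteSpace (Mult H) := by
  rw [completeSpace_iff_isComplete_range isUniformInducing_mulOp]
  refine IsClosed.isComplete ?_
  have hrange : Set.range (mulOp H) =
      {T : H →L[ℂ] H | ∀ (f : H) (x : X), T f x = T e x * f x} := by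
    ext T
    constructor
    · rintro ⟨φ, rfl⟩ f x
      rw [mulOp_apply_of_eq_one he, mulOp_apply]
    · intro hT
      refine ⟨⟨T e, fun f => ⟨T f, funext (hT f)⟩⟩, ?_⟩
      ext f x
      exact (mulOp_apply _ f x).trans (hT f x).symm
  rw [hrange]
  simp only [Set.ofPred_forall]
  have hc : ∀ (f : H) (x : X), Continuous fun T : H →L[ℂ] H => T f x := fun f x =>
    (RKHS.continuous_eval x).comp (by fun_prop)
  exact isClosed_iInter fun f => isClosed_iInter fun x =>
    isClosed_eq (hc f x) ((hc e x).mul continuous_const)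

/-- Evaluation at a point as a character of the multiplier algebra. -/
def evalCharacter {e : H} (he : ∀ x, e x = 1) (x : X) : MaxIdealSpace H :=
  ⟨StrongDual.toWeakDual
    { toFun := fun φ : Mult H => φ x
      map_add' := fun _ _ => rfl
      map_smul' := fun _ _ => rfl
      cont := by
        simp only [← mulOp_apply_of_eq_one he]
        have : Continuous (mulOp H) := isUniformInducing_mulOp.isInducing.continuous
        exact (RKHS.continuous_eval x).comp (by fun_prop) },
    fun h => one_ne_zero (α := ℂ) (DFunLike.congr_fun h (1 : Mult H)), fun _ _ => rfl⟩

/-- The inclusion of `H` into `Mult(H)` if every function in `H` is a multiplier. -/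
def toMultLinear (h : ∀ f : H, (f : X → ℂ) ∈ multiplierAlgebra H) : H →ₗ[ℂ] Mult H where
  toFun f := ⟨f, h f⟩
  map_add' f g := Subtype.ext (RKHS.coe_add f g)
  map_smul' c f := Subtype.ext (RKHS.coe_smul f c)

/-- If every function in `H` is a multiplier, then the inclusion of `H` into `Mult(H)` is
continuous. -/
def toMult (h : ∀ f : H, (f : X → ℂ) ∈ multiplierAlgebra H) : H →L[ℂ] Mult H where
  toLinearMap := toMultLinear h
  cont := by
    let M : H →ₗ[ℂ] (H →L[ℂ] H) := (mulOp H).toLinearMap ∘ₗ toMultLinear h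
    refine isUniformInducing_mulOp.isInducing.continuous_iff.2 (?_ : Continuous M)
    refine LinearMap.continuous_of_seq_closed_graph _ fun u f T hu hM => ?_
    ext g x
    have hT : Filter.Tendsto (fun n => M (u n) g x) Filter.atTop (nhds (T g x)) :=
      (((RKHS.continuous_eval x).comp (by fun_prop : Continuous fun T : H →L[ℂ] H => T g)).tendsto
        T).comp hM
    have hf := (((RKHS.continuous_eval (H := H) x).tendsto f).comp hu).mul_const (g x)
    have hM : ∀ f : H, M f g x = f x * g x := fun f => mulOp_apply _ g x
    rw [hM]
    simp only [hM] at hT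
    exact tendsto_nhds_unique hT hf

theorem toMult_apply (h : ∀ f : H, (f : X → ℂ) ∈ multiplierAlgebra H) (f : H) (x : X) :
    toMult h f x = f x := rfl

/-- Composing `χ` with the bounded inclusion of `H` gives a partially multiplicative functional. Its
evaluation point serves all of `Mult H` because `φ = φ · 1` lies in `H`. -/
theorem exists_character_eq_eval {e : H} (he : ∀ x, e x = 1) (hmax : IsMaximalDomain H)
    (h : ∀ f : H, (f : X → ℂ) ∈ multiplierAlgebra H) (χ : MaxIdealSpace H) :
    ∃ x : X, ∀ φ : Mult H, χ φ = φ x := by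
  have hρ : IsPartiallyMultiplicative H
      ((WeakDual.CharacterSpace.toCLM χ).comp (toMult h)) := by
    refine ⟨fun h0 => ?_, fun f g k hk => ?_⟩
    · have h1 : toMult h e = 1 := DFunLike.ext _ _ fun y => he y
      have h2 := DFunLike.congr_fun h0 e
      rw [ContinuousLinearMap.comp_apply, h1] at h2
      exact one_ne_zero (α := ℂ) ((map_one χ).symm.trans h2)
    · have h1 : toMult h k = toMult h f * toMult h g :=
        DFunLike.ext _ _ fun y => congrFun hk y
      simp only [ContinuousLinearMap.comp_apply, h1]
      exact map_mul χ _ _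
  obtain ⟨x, hx⟩ := hmax _ hρ
  refine ⟨x, fun φ => ?_⟩
  have hφ : toMult h (mulOp H φ e) = φ := DFunLike.ext _ _ fun y => by
    rw [toMult_apply, mulOp_apply_of_eq_one he]
  have := hx (mulOp H φ e)
  rw [mulOp_apply_of_eq_one he] at this
  rw [← this, ContinuousLinearMap.comp_apply, hφ]
  rfl

theorem continuous_evalCharacter [TopologicalSpace X] {e : H} (he : ∀ x, e x = 1)
    (hcont : ∀ f : H, Continuous (f : X → ℂ)) :
    Continuous (evalCharacter he : X → MaxIdealSpace H) := by
  refine Continuous.subtype_mk (WeakDual.continuous_of_continuous_eval fun φ => ?_) _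
  refine (hcont (mulOp H φ e)).congr fun x => ?_
  exact mulOp_apply_of_eq_one he φ x

/-- The condition `c ≤ ‖χ φ‖` is closed in `χ` and holds at evaluations, so by density no character
kills `φ`. -/
theorem OneFunctionCoronaTheorem.of_coronaTheorem {e : H} (he : ∀ x, e x = 1)
    (h : CoronaTheorem H) : OneFunctionCoronaTheorem H := by
  rintro φ hφ ⟨c, hc, hcφ⟩
  have := Mult.completeSpace he
  let φ' : Mult H := ⟨φ, hφ⟩
  have hunit : IsUnit φ' := by
    by_contra hu
    obtain ⟨χ, hχ⟩ := exists_character_apply_eq_zero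
      (fun _ => Mult.eq_zero_of_norm_eq_zero he) hu
    have hclosed : IsClosed {χ : MaxIdealSpace H | c ≤ ‖χ φ'‖} :=
      isClosed_le continuous_const
        ((WeakDual.eval_continuous φ').comp continuous_subtype_val).norm
    have hmem : χ ∈ {χ : MaxIdealSpace H | c ≤ ‖χ φ'‖} := by
      refine hclosed.closure_subset_iff.2 ?_ (h χ)
      rintro χ' ⟨x, hx⟩
      rw [Set.mem_ofPred_eq, hx]
      exact hcφ x
    rw [Set.mem_ofPred_eq, hχ, norm_zero] at hmem
    exact absurd hmem (not_le.2 hc)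
  obtain ⟨ψ, hψ⟩ := hunit.exists_right_inv
  have hx : (fun x => 1 / φ x) = ψ := funext fun x => by
    have : φ x * ψ x = 1 := congrArg (fun θ : Mult H => θ x) hψ
    rw [one_div, inv_eq_of_mul_eq_one_right this]
  rw [hx]
  exact ψ.2

end Mult

end PickSpace
end

/-! ### The cycle of implications. -/

theorem proposition1p5 {X : Type*} [TopologicalSpace X] [CompactSpace X]
    (H : Type*) [NormedAddCommGroup H] [InnerProductSpace ℂ H] [CompleteSpace H]
    [RKHS ℂ H X ℂ]
    (hnorm : PickSpace.IsNormalized H) (hpick : PickSpace.IsCompletePick H)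
    (hcont : ∀ f : H, Continuous (f : X → ℂ))
    (hsep : ∀ x y : X, x ≠ y → ∃ f : H, f x ≠ f y)
    (hmax : PickSpace.IsMaximalDomain H) :
    List.TFAE [
      Subalgebra.toSubmodule (PickSpace.multiplierAlgebra H) =
        LinearMap.range (RKHS.coeCLM ℂ : H →L[ℂ] (X → ℂ)).toLinearMap,
      PickSpace.CoronaTheorem H,
      ∃ e : X ≃ₜ PickSpace.MaxIdealSpace H,
        ∀ (x : X) (φ : PickSpace.Mult H), e x φ = φ x,
      PickSpace.OneFunctionCoronaTheorem H,
      ∀ φ ∈ PickSpace.multiplierAlgebra H, (∀ x : X, φ x ≠ 0) →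
        (fun x => 1 / φ x) ∈ PickSpace.multiplierAlgebra H] := by
  obtain ⟨e, he⟩ : ∃ e : H, ∀ x : X, e x = 1 := by
    obtain ⟨x₀, h₀⟩ := hnorm
    exact ⟨PickSpace.kerVec H x₀, fun x => by rw [PickSpace.kerVec_apply, h₀]⟩
  have hsub : ∀ φ ∈ PickSpace.multiplierAlgebra H, ∃ g : H, (g : X → ℂ) = φ := by
    intro φ hφ
    obtain ⟨g, hg⟩ := hφ e
    exact ⟨g, hg.trans (funext fun x => by rw [Pi.mul_apply, he, mul_one])⟩
  tfae_have 1 → 3 := by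
    intro h
    have hmem : ∀ f : H, (f : X → ℂ) ∈ PickSpace.multiplierAlgebra H := fun f => by
      rw [← Subalgebra.mem_toSubmodule, h]
      exact ⟨f, rfl⟩
    have hbij : Function.Bijective (PickSpace.evalCharacter he) := by
      constructor
      · intro x y hxy
        by_contra hne
        obtain ⟨f, hf⟩ := hsep x y hne
        exact hf (DFunLike.congr_fun hxy (PickSpace.toMult hmem f))
      · intro χ
        obtain ⟨x, hx⟩ := PickSpace.exists_character_eq_eval he hmax hmem χ
        exact ⟨x, DFunLike.ext _ _ fun φ => (hx φ).symm⟩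
    exact ⟨Continuous.homeoOfEquivCompactToT2 (f := Equiv.ofBijective _ hbij)
      (PickSpace.continuous_evalCharacter he hcont), fun x φ => rfl⟩
  tfae_have 3 → 2 := by
    rintro ⟨E, hE⟩ χ
    refine subset_closure ⟨E.symm χ, fun φ => ?_⟩
    rw [← hE, E.apply_symm_apply]
  tfae_have 2 → 4 := PickSpace.OneFunctionCoronaTheorem.of_coronaTheorem he
  tfae_have 4 → 5 := by
    intro h φ hφ h0
    refine h φ hφ ?_
    obtain ⟨g, hg⟩ := hsub φ hφ
    -- The normalization point shows that `X` is nonempty, so `‖φ‖` attains its minimum.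
    obtain ⟨x₀, -⟩ := hnorm
    have hφc : Continuous φ := hg ▸ hcont g
    obtain ⟨y, -, hy⟩ := isCompact_univ.exists_isMinOn ⟨x₀, Set.mem_univ _⟩ hφc.norm.continuousOn
    exact ⟨‖φ y‖, norm_pos_iff.2 (h0 y), fun x => hy (Set.mem_univ x)⟩
  tfae_have 5 → 1 := by
    intro h
    refine le_antisymm (fun φ hφ => hsub φ hφ) ?_
    rintro _ ⟨f, rfl⟩
    obtain ⟨η, hη, hη0, hfη⟩ := hpick.exists_multiplier_quotient hnorm f
    -- This is `f = (f η) · (1/η)`.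
    have hmul := mul_mem hfη (h η hη hη0)
    rw [Subalgebra.mem_toSubmodule]
    convert hmul using 1
    ext x
    have := hη0 x
    simp
    field_simp
  tfae_finish
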